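/- Let $X$ be a (real or complex) Banach space and let $T : X \to X$ be an invertible continuous linear operator with continuous inverse. Suppose that $T$ is topologically stable: for every neighborhood $V$ of $0$ in $X$ there is a neighborhood $U$ of $0$ in $X$ such that for every homeomorphism $S : X \to X$ (not necessarily linear) with $Tx - Sx \in U$ for all $x \in X$, there is a continuous map $\phi : X \to X$ with $T \circ \phi = \phi \circ S$ and $\phi(x) - x \in V$ for all $x \in X$. Then: 1. $T$ has the shadowing property: for every neighborhood $V$ of $0$ in $X$ there is a neighborhood $U$ of $0$ in $X$ such that for every sequence $(x_j)_{j \in \mathbb{Z}}$ in $X$ with $Tx_j - x_{j+1} \in U$ for all $j \in \mathbb{Z}$, there is $a \in X$ with $x_j - T^j a \in V$ for all $j \in \mathbb{Z}$. 2. $T$ has the strict periodic shadowing property: for every neighborhood $V$ of $0$ in $X$ there is a neighborhood $U$ of $0$ in $X$ such that for every integer $k \geq 1$ and every sequence $(x_j)_{j \geq 0}$ in $X$ with $x_{j+k} = x_j$ and $Tx_j - x_{j+1} \in U$ for all $j \geq 0$, there is $a \in X$ with $T^k a = a$ and $x_j - T^j a \in V$ for all $j \geq 0$. -/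

import Mathlib

open Topology

namespace OperatorDynamics

section Definitions

variable {𝕜 : Type*} [RCLike 𝕜] {X : Type*} [AddCommGroup X] [Module 𝕜 X] [TopologicalSpace X]

/-- An invertible operator `T` on a topological vector space (linear homeomorphism) is
topologically stable if for every neighborhood `V` of `0` there is a neighborhood `U` of `0` such
that for every homeomorphism `S` of `X` (not necessarily linear) with `T x - S x ∈ U` for all `x`,
there is a continuous map `φ` with `T ∘ φ = φ ∘ S` and `φ x - x ∈ V` for all `x`. -/
def IsTopologicallyStable (T : X ≃L[𝕜] X) : Prop :=
  ∀ V ∈ 𝓝 (0 : X), ∃ U ∈ 𝓝 (0 : X), ∀ S : X ≃ₜ X, (∀ x : X, T x - S x ∈ U) →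
    ∃ φ : X → X, Continuous φ ∧ (∀ x : X, T (φ x) = φ (S x)) ∧ ∀ x : X, φ x - x ∈ V

/-- `(x j)` for `j ∈ ℤ` is a two-sided infinite `U`-pseudotrajectory of `T`. -/
def IsBilateralPseudotrajectory (T : X →L[𝕜] X) (U : Set X) (x : ℤ → X) : Prop :=
  ∀ j : ℤ, T (x j) - x (j + 1) ∈ U

/-- `(x j)` for `j ∈ ℕ = {0, 1, 2, …}` is a one-sided infinite `U`-pseudotrajectory of `T`. -/
def IsPseudotrajectory (T : X →L[𝕜] X) (U : Set X) (x : ℕ → X) : Prop :=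
  ∀ j : ℕ, T (x j) - x (j + 1) ∈ U

/-- The (two-sided) shadowing property of an invertible operator; the powers `T ^ j`, `j ∈ ℤ`, are
taken in the group of invertible operators on `X`. -/
def HasShadowingProperty (T : X ≃L[𝕜] X) : Prop :=
  ∀ V ∈ 𝓝 (0 : X), ∃ U ∈ 𝓝 (0 : X), ∀ x : ℤ → X,
    IsBilateralPseudotrajectory (T : X →L[𝕜] X) U x →
      ∃ a : X, ∀ j : ℤ, x j - (T ^ j : X ≃L[𝕜] X) a ∈ V

/-- The strict periodic shadowing property of an operator: every `U`-pseudotrajectory `(x j)`,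
`j ∈ ℕ`, of period `k ≥ 1` is `V`-shadowed by the trajectory of a point `a` with `T ^ k a = a`. -/
def HasStrictPeriodicShadowingProperty (T : X →L[𝕜] X) : Prop :=
  ∀ V ∈ 𝓝 (0 : X), ∃ U ∈ 𝓝 (0 : X), ∀ (x : ℕ → X) (k : ℕ), 1 ≤ k → Function.Periodic x k →
    IsPseudotrajectory T U x →
      ∃ a : X, T^[k] a = a ∧ ∀ j : ℕ, x j - T^[j] a ∈ V

end Definitions

end OperatorDynamics

open OperatorDynamics

section

variable {𝕜 : Type*} [RCLike 𝕜] {X : Type*} [NormedAddCommGroup X] [NormedSpace 𝕜 X]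

/-! Stability is reduced to a linear statement (`FiniteSolvable`): `y (j + 1) = T (y j) + e j` is
solvable on every finite interval, with one bound for all `e` in the unit ball.

If `S = T + f` and `T ∘ φ = φ ∘ S`, then along an `S`-orbit `x j` the displacement `y j = φ (x j) -
x j` is bounded and satisfies `y (j + 1) = T (y j) - f (x j)`. So `f` should take prescribed values
along an orbit while staying Lipschitz-small, which is possible when the orbit points are far apart.
Starting at `R • v` with `R` large achieves this if the first `T`-iterates of `v` are distinct. Such
`v` exist unless some `T^[k]` with `k > 0` is the identity, and such periodic operators are not
stable on a nontrivial space.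

Conversely, finite solutions are glued over `ℤ`, or averaged over a cycle, into approximate
solutions. Iterating on the residual makes them exact, and subtracting an exact solution from a
pseudotrajectory leaves a true orbit. -/

/-! ### From approximate to exact solutions of the linear equation. -/

/-- If the equation `y (σ i) = T (y i) + e i` can be solved up to an error `1 / 2` for all `e` in the
unit ball of `ℓ^∞`, then it can be solved exactly. -/
theorem exists_solution_of_approx [CompleteSpace X] {ι : Type*} (σ : ι → ι) (T : X →L[𝕜] X) {C : ℝ}
    (h : ∀ e : ι → X, (∀ i, ‖e i‖ ≤ 1) → ∃ y : ι → X, (∀ i, ‖y i‖ ≤ C) ∧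
      ∀ i, ‖y (σ i) - T (y i) - e i‖ ≤ 1 / 2)
    (e : ι → X) (he : ∀ i, ‖e i‖ ≤ 1) :
    ∃ y : ι → X, (∀ i, ‖y i‖ ≤ 2 * C) ∧ ∀ i, y (σ i) = T (y i) + e i := by
  choose! Y hY hYe using h
  -- The residual has norm at most `1 / 2`, so twice the residual is again admissible data; the
  -- `n`-th correction is weighted by `2⁻ⁿ`.
  let r : (ι → X) → ι → X := fun e i => (2 : 𝕜) • (e i - (Y e (σ i) - T (Y e i)))
  let E : ℕ → ι → X := fun n => r^[n] e
  have hEs : ∀ n, E (n + 1) = r (E n) := fun n => Function.iterate_succ_apply' r n e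
  have hE : ∀ n i, ‖E n i‖ ≤ 1 := by
    intro n
    induction n with
    | zero => exact he
    | succ n ih =>
      intro i
      rw [hEs]
      have := hYe (E n) ih i
      rw [norm_sub_rev] at this
      simp only [r, norm_smul, RCLike.norm_ofNat]
      linarith
  let q : 𝕜 := 2⁻¹
  have hq : ‖q‖ = 1 / 2 := by simp [q]
  let y : ℕ → ι → X := fun n i => q ^ n • Y (E n) i
  have hy : ∀ n i, ‖y n i‖ ≤ C * (1 / 2) ^ n := by
    intro n i
    simp only [y, norm_smul, norm_pow, hq]
    rw [mul_comm]
    exact mul_le_mul_of_nonneg_right (hY _ (hE n) i) (by positivity)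
  have hg : HasSum (fun n : ℕ => C * (1 / 2 : ℝ) ^ n) (C * 2) := hasSum_geometric_two.mul_left C
  have hs : ∀ i, Summable fun n => y n i := fun i =>
    Summable.of_norm_bounded hg.summable fun n => hy n i
  refine ⟨fun i => ∑' n, y n i, fun i => ?_, fun i => ?_⟩
  · rw [mul_comm]
    exact tsum_of_norm_bounded hg fun n => hy n i
  · have hpart : ∀ n, ∑ m ∈ Finset.range n, (y m (σ i) - T (y m i)) = e i - q ^ n • E n i := by
      intro n
      induction n with
      | zero => simp [E]
      | succ n ih =>
        rw [Finset.sum_range_succ, ih, hEs]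
        have h2 : q ^ (n + 1) * 2 = q ^ n := by simp [q, pow_succ]
        simp only [y, r, smul_smul, h2, map_smul, smul_sub]
        abel
    have hsum := ((hs (σ i)).hasSum.sub ((hs i).hasSum.mapL T)).tendsto_sum_nat
    have hlim : Filter.Tendsto (fun n => e i - q ^ n • E n i) Filter.atTop (𝓝 (e i - 0)) := by
      refine tendsto_const_nhds.sub ?_
      refine squeeze_zero_norm (a := fun n => (1 / 2 : ℝ) ^ n) (fun n => ?_)
        (tendsto_pow_atTop_nhds_zero_of_lt_one (by norm_num) (by norm_num))
      rw [norm_smul, norm_pow, hq]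
      exact mul_le_of_le_one_right (by positivity) (hE n i)
    have := tendsto_nhds_unique (hsum.congr hpart) hlim
    rw [sub_zero, sub_eq_iff_eq_add'] at this
    exact this

/-! ### Finite solvability and its extension to `ℤ` and to cycles. -/

/-- `T` solves `y (j + 1) = T (y j) + e j` on all finite intervals with the uniform bound `C`. -/
def FiniteSolvable (T : X →L[𝕜] X) (C : ℝ) : Prop :=
  ∀ (n : ℕ) (e : ℕ → X), (∀ j, ‖e j‖ ≤ 1) → ∃ y : ℕ → X, (∀ j ≤ n, ‖y j‖ ≤ C) ∧
    ∀ j < n, y (j + 1) = T (y j) + e j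

theorem FiniteSolvable.nonneg {T : X →L[𝕜] X} {C : ℝ} (h : FiniteSolvable T C) : 0 ≤ C := by
  obtain ⟨y, hy, -⟩ := h 0 0 (by simp)
  exact (norm_nonneg _).trans (hy 0 le_rfl)

theorem FiniteSolvable.exists_window {T : X →L[𝕜] X} {C : ℝ} (h : FiniteSolvable T C) (n : ℕ)
    (e : ℤ → X) (he : ∀ j, ‖e j‖ ≤ 1) (s : ℤ) :
    ∃ w : ℤ → X, (∀ j, s ≤ j → j ≤ s + n → ‖w j‖ ≤ C) ∧
      ∀ j, s ≤ j → j < s + n → w (j + 1) = T (w j) + e j := by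
  obtain ⟨y, hy, hye⟩ := h n (fun i => e (s + i)) fun i => he _
  refine ⟨fun j => y (j - s).toNat, fun j h1 h2 => hy _ (by omega), fun j h1 h2 => ?_⟩
  have h3 : (j + 1 - s).toNat = (j - s).toNat + 1 := by omega
  have h4 : s + ((j - s).toNat : ℤ) = j := by omega
  simp only [h3]
  rw [hye _ (by omega), h4]

/-- Convex interpolation between solutions on overlapping windows of length `2 N`. -/
theorem FiniteSolvable.exists_approx_int {T : X →L[𝕜] X} {C : ℝ} (h : FiniteSolvable T C)
    (e : ℤ → X) (he : ∀ j, ‖e j‖ ≤ 1) :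
    ∃ y : ℤ → X, (∀ j, ‖y j‖ ≤ 2 * C) ∧ ∀ j, ‖y (j + 1) - T (y j) - e j‖ ≤ 1 / 2 := by
  obtain ⟨N, hN⟩ := exists_nat_gt (4 * C)
  have hC := h.nonneg
  have hN0 : (0 : ℝ) < N := by linarith
  have hNZ : (0 : ℤ) < N := by exact_mod_cast hN0
  have hNk : (N : 𝕜) ≠ 0 := by exact_mod_cast hN0.ne'
  choose w hw hwe using fun m : ℤ => h.exists_window (2 * N) e he (m * N - N)
  -- Windows `m` and `m + 1` both cover the block from `m * N` to `(m + 1) * N`, where the weight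
  -- passes from one to the other in steps of `1 / N`. The error is at most `2 * C / N < 1 / 2`.
  let f : ℤ → ℤ → X := fun m j =>
    (1 - ((j - m * N : ℤ) : 𝕜) / N) • w m j + (((j - m * N : ℤ) : 𝕜) / N) • w (m + 1) j
  let y : ℤ → X := fun j => f (j / N) j
  -- At the end of a block only `w (m + 1)` has weight, so the formulas of adjacent blocks agree
  -- there.
  have hstep : ∀ j, y (j + 1) = f (j / N) (j + 1) := by
    intro j
    have h1 := Int.emod_add_mul_ediv j N
    have h2 := Int.emod_nonneg j hNZ.ne'
    have h3 := Int.emod_lt_of_pos j hNZ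
    rcases (show j % N + 1 < N ∨ j % N + 1 = N by omega) with h4 | h4
    · have : (j + 1) / N = j / N := by
        rw [Int.ediv_eq_iff_of_pos hNZ]
        constructor <;> nlinarith
      simp only [y, this]
    · have : (j + 1) / N = j / N + 1 := by
        rw [Int.ediv_eq_iff_of_pos hNZ]
        constructor <;> nlinarith
      have h5 : j + 1 - (j / N + 1) * N = 0 := by linarith [mul_comm (j / N) (N : ℤ)]
      have h6 : j + 1 - j / N * N = N := by linarith [mul_comm (j / N) (N : ℤ)]
      simp only [y, f, this, h5, h6]
      simp [hNk]
  refine ⟨y, fun j => ?_, fun j => ?_⟩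
  all_goals
    have h1 := Int.emod_add_mul_ediv j N
    have h2 := Int.emod_nonneg j hNZ.ne'
    have h3 := Int.emod_lt_of_pos j hNZ
    have h7 : j - j / N * N = j % N := by linarith [mul_comm (j / N) (N : ℤ)]
    have h8 : (j / N + 1) * (N : ℤ) = j / N * N + N := by ring
  · have ht0 : (0 : ℝ) ≤ (j % N : ℤ) / N := by positivity
    have ht1 : ((j % N : ℤ) : ℝ) / N ≤ 1 := by
      rw [div_le_one hN0]
      exact_mod_cast h3.le
    have hn1 : ‖((j % N : ℤ) : 𝕜) / N‖ ≤ 1 := by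
      have : ((j % N : ℤ) : 𝕜) / N = (((j % N : ℤ) : ℝ) / N : ℝ) := by push_cast; rfl
      rw [this, RCLike.norm_ofReal, abs_of_nonneg ht0]
      exact ht1
    have hn2 : ‖1 - ((j % N : ℤ) : 𝕜) / N‖ ≤ 1 := by
      have : 1 - ((j % N : ℤ) : 𝕜) / N = ((1 - ((j % N : ℤ) : ℝ) / N : ℝ) : 𝕜) := by
        push_cast; rfl
      rw [this, RCLike.norm_ofReal, abs_of_nonneg (by linarith)]
      linarith
    simp only [y, f, h7]
    have ha := hw (j / N) j (by omega) (by push_cast; omega)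
    have hb := hw (j / N + 1) j (by omega) (by push_cast; omega)
    calc _ ≤ _ := norm_add_le _ _
      _ ≤ 1 * C + 1 * C := by
        rw [norm_smul, norm_smul]
        gcongr
      _ = 2 * C := by ring
  · have ha := hwe (j / N) j (by omega) (by push_cast; omega)
    have hb := hwe (j / N + 1) j (by omega) (by push_cast; omega)
    have ha' := hw (j / N) (j + 1) (by omega) (by push_cast; omega)
    have hb' := hw (j / N + 1) (j + 1) (by omega) (by push_cast; omega)
    have key : y (j + 1) - T (y j) - e j =
        (N : 𝕜)⁻¹ • (w (j / N + 1) (j + 1) - w (j / N) (j + 1)) := by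
      have h9 : ((j + 1 - j / N * N : ℤ) : 𝕜) / N = ((j % N : ℤ) : 𝕜) / N + (N : 𝕜)⁻¹ := by
        rw [show j + 1 - j / N * N = j % N + 1 by linarith]
        push_cast
        rw [add_div, one_div]
      rw [hstep]
      simp only [y, f, h7, h9, map_add, map_smul]
      generalize ((j % N : ℤ) : 𝕜) / N = t
      rw [ha, hb]
      module
    rw [key, norm_smul, norm_inv, RCLike.norm_natCast, inv_mul_le_iff₀ hN0]
    calc _ ≤ _ := norm_sub_le _ _
      _ ≤ C + C := add_le_add hb' ha'
      _ ≤ _ := by linarith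

/-- Averaging a solution on a long interval over the periods. -/
theorem FiniteSolvable.exists_approx_zmod {T : X →L[𝕜] X} {C : ℝ} (h : FiniteSolvable T C)
    (k : ℕ) [NeZero k] (e : ZMod k → X) (he : ∀ j, ‖e j‖ ≤ 1) :
    ∃ y : ZMod k → X, (∀ j, ‖y j‖ ≤ C) ∧ ∀ j, ‖y (j + 1) - T (y j) - e j‖ ≤ 1 / 2 := by
  obtain ⟨M, hM⟩ := exists_nat_gt (4 * C)
  have hC := h.nonneg
  have hM0 : (0 : ℝ) < M := by linarith
  have hMk : (M : 𝕜) ≠ 0 := by exact_mod_cast hM0.ne'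
  obtain ⟨y, hy, hye⟩ := h (M * k) (fun i => e i) fun i => he _
  let w : ℕ → X := fun r => (M : 𝕜)⁻¹ • ∑ i ∈ Finset.range M, y (r + i * k)
  have hlt : ∀ r < k, ∀ i < M, r + i * k < M * k := by
    intro r hr i hi
    nlinarith
  have hw : ∀ r < k, w (r + 1) = T (w r) + e r := by
    intro r hr
    have h1 : ∀ i ∈ Finset.range M, y (r + 1 + i * k) = T (y (r + i * k)) + e r := by
      intro i hi
      rw [show r + 1 + i * k = r + i * k + 1 by ring, hye _ (hlt r hr i (Finset.mem_range.1 hi))]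
      simp
    simp only [w]
    rw [Finset.sum_congr rfl h1, Finset.sum_add_distrib, map_smul, map_sum, smul_add,
      Finset.sum_const, Finset.card_range, ← Nat.cast_smul_eq_nsmul 𝕜, smul_smul,
      inv_mul_cancel₀ hMk, one_smul]
  -- The averages solve the equation exactly within a period; the only defect is at the wrap-around,
  -- where it telescopes to at most `2 * C / M < 1 / 2`.
  have hwk : w k - w 0 = (M : 𝕜)⁻¹ • (y (M * k) - y 0) := by
    simp only [w]
    rw [← smul_sub, ← Finset.sum_sub_distrib]
    have := Finset.sum_range_sub (fun i => y (i * k)) M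
    simp only [zero_mul] at this
    rw [← this]
    congr 1
    refine Finset.sum_congr rfl fun i _ => ?_
    rw [show k + i * k = (i + 1) * k by ring, zero_add]
  refine ⟨fun j => w j.val, fun j => ?_, fun j => ?_⟩
  · simp only [w]
    rw [norm_smul, norm_inv, RCLike.norm_natCast, inv_mul_le_iff₀ hM0]
    calc _ ≤ ∑ i ∈ Finset.range M, C := norm_sum_le_of_le _ fun i hi =>
          hy _ (hlt _ j.val_lt i (Finset.mem_range.1 hi)).le
      _ = _ := by simp
  · have hj := hw j.val j.val_lt
    rw [ZMod.natCast_rightInverse j] at hj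
    rcases (show j.val + 1 < k ∨ j.val + 1 = k by have := j.val_lt; omega) with h1 | h1
    · have h2 : (j + 1).val = j.val + 1 := by
        rw [← ZMod.val_natCast_of_lt h1, Nat.cast_add, Nat.cast_one, ZMod.natCast_rightInverse j]
      simp only [h2, hj]
      simp
    · have h2 : j + 1 = 0 := by
        rw [← ZMod.natCast_rightInverse j]
        exact_mod_cast (congrArg (Nat.cast : ℕ → ZMod k) h1).trans (ZMod.natCast_self k)
      have h3 : w (j + 1).val - T (w j.val) - e j = -(w k - w 0) := by
        rw [h1] at hj
        rw [h2, hj, ZMod.val_zero]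
        abel
      simp only [h3]
      rw [hwk, norm_neg, norm_smul, norm_inv, RCLike.norm_natCast, inv_mul_le_iff₀ hM0]
      calc _ ≤ _ := norm_sub_le _ _
        _ ≤ C + C := add_le_add (hy _ le_rfl) (hy _ (Nat.zero_le _))
        _ ≤ _ := by linarith

/-! ### From solvability to shadowing. -/

/-- Scaled form of solvability. -/
theorem solvable_of_unit {ι : Type*} {σ : ι → ι} {T : X →L[𝕜] X} {C : ℝ}
    (h : ∀ e : ι → X, (∀ i, ‖e i‖ ≤ 1) → ∃ y : ι → X, (∀ i, ‖y i‖ ≤ C) ∧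
      ∀ i, y (σ i) = T (y i) + e i) {r : ℝ} (hr : 0 < r) (e : ι → X) (he : ∀ i, ‖e i‖ ≤ r) :
    ∃ y : ι → X, (∀ i, ‖y i‖ ≤ r * C) ∧ ∀ i, y (σ i) = T (y i) + e i := by
  have hrk : (r : 𝕜) ≠ 0 := by exact_mod_cast hr.ne'
  obtain ⟨y, hy, hye⟩ := h (fun i => (r : 𝕜)⁻¹ • e i) fun i => by
    rw [norm_smul, norm_inv, RCLike.norm_ofReal, abs_of_pos hr, inv_mul_le_iff₀ hr, mul_one]
    exact he i
  refine ⟨fun i => (r : 𝕜) • y i, fun i => ?_, fun i => ?_⟩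
  · rw [norm_smul, RCLike.norm_ofReal, abs_of_pos hr]
    exact mul_le_mul_of_nonneg_left (hy i) hr.le
  · simp only [hye, smul_add, map_smul, smul_smul, mul_inv_cancel₀ hrk, one_smul]

/-- With the one-step errors as forcing term, `x - y` is a genuine orbit and `y` is the shadowing
error. The bound `4 * C` comes from two doublings, in the interpolation and in the residual
iteration. -/
theorem FiniteSolvable.hasShadowingProperty [CompleteSpace X] {T : X ≃L[𝕜] X} {C : ℝ}
    (h : FiniteSolvable (T : X →L[𝕜] X) C) : HasShadowingProperty T := by
  intro V hV
  obtain ⟨ε, hε, hεV⟩ := Metric.mem_nhds_iff.1 hV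
  have hC := h.nonneg
  have hr : 0 < ε / (4 * C + 1) := by positivity
  refine ⟨Metric.ball 0 (ε / (4 * C + 1)), Metric.ball_mem_nhds _ hr, fun x hx => ?_⟩
  obtain ⟨y, hy, hye⟩ := solvable_of_unit
    (exists_solution_of_approx (fun j : ℤ => j + 1) (T : X →L[𝕜] X) h.exists_approx_int)
    hr (fun j => x (j + 1) - T (x j)) fun j => by
      have := mem_ball_zero_iff.1 (hx j)
      rw [norm_sub_rev] at this
      exact this.le
  have ha : ∀ j, x (j + 1) - y (j + 1) = T (x j - y j) := by
    intro j
    rw [hye, map_sub, ContinuousLinearEquiv.coe_coe]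
    abel
  have hT : ∀ j : ℤ, (T ^ (j + 1)) (x 0 - y 0) = T ((T ^ j) (x 0 - y 0)) := by
    intro j
    rw [add_comm, zpow_one_add]
    rfl
  have hall : ∀ j : ℤ, x j - y j = (T ^ j) (x 0 - y 0) := by
    intro j
    induction j using Int.induction_on with
    | zero => rfl
    | succ i ih => rw [ha, hT, ih]
    | pred i ih =>
      apply T.injective
      rw [← ha, ← hT, sub_add_cancel, ih]
  refine ⟨x 0 - y 0, fun j => hεV ?_⟩
  rw [← hall, sub_sub_cancel, mem_ball_zero_iff]
  refine (hy j).trans_lt ?_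
  rw [div_mul_eq_mul_div, div_lt_iff₀ (by positivity)]
  nlinarith

/-- Solving over `ZMod k` makes the correction `y` itself periodic, so the orbit `x - y` closes up
after `k` steps. -/
theorem FiniteSolvable.hasStrictPeriodicShadowingProperty [CompleteSpace X] {T : X →L[𝕜] X} {C : ℝ}
    (h : FiniteSolvable T C) : HasStrictPeriodicShadowingProperty T := by
  intro V hV
  obtain ⟨ε, hε, hεV⟩ := Metric.mem_nhds_iff.1 hV
  have hC := h.nonneg
  have hr : 0 < ε / (2 * C + 1) := by positivity
  refine ⟨Metric.ball 0 (ε / (2 * C + 1)), Metric.ball_mem_nhds _ hr, fun x k hk hper hx => ?_⟩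
  have : NeZero k := ⟨by omega⟩
  obtain ⟨y, hy, hye⟩ := solvable_of_unit
    (exists_solution_of_approx (fun j : ZMod k => j + 1) T (h.exists_approx_zmod k))
    hr (fun j => x (j.val + 1) - T (x j.val)) fun j => by
      have := mem_ball_zero_iff.1 (hx j.val)
      rw [norm_sub_rev] at this
      exact this.le
  have ha : ∀ j : ℕ, x (j + 1) - y (j + 1 : ℕ) = T (x j - y j) := by
    intro j
    have h1 : x (j % k + 1) = x (j + 1) := by
      rw [← hper.map_mod_nat (j % k + 1), ← hper.map_mod_nat (j + 1), Nat.mod_add_mod]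
    rw [Nat.cast_add, Nat.cast_one, hye, map_sub, ZMod.val_natCast, h1, hper.map_mod_nat]
    abel
  have hall : ∀ j : ℕ, x j - y j = T^[j] (x 0 - y (0 : ℕ)) := by
    intro j
    induction j with
    | zero => rfl
    | succ i ih => rw [ha, Function.iterate_succ_apply', ih]
  refine ⟨x 0 - y (0 : ℕ), ?_, fun j => hεV ?_⟩
  · have := hper 0
    rw [zero_add] at this
    rw [← hall, this, ZMod.natCast_self, Nat.cast_zero]
  · rw [← hall, sub_sub_cancel, mem_ball_zero_iff]
    refine (hy _).trans_lt ?_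
    rw [div_mul_eq_mul_div, div_lt_iff₀ (by positivity)]
    nlinarith

/-! ### Lipschitz perturbations and the exclusion of periodic operators. -/

/-- A perturbation of `T` with a small Lipschitz constant is a homeomorphism. -/
theorem exists_homeomorph_add [CompleteSpace X] (T : X ≃L[𝕜] X) :
    ∃ c : ℝ, 0 < c ∧ ∀ f : X → X, (∀ x y, ‖f x - f y‖ ≤ c * ‖x - y‖) →
      ∃ S : X ≃ₜ X, ∀ x, S x = T x + f x := by
  rcases subsingleton_or_nontrivial X with hX | hX
  · exact ⟨1, one_pos, fun f _ => ⟨Homeomorph.refl X, fun x => Subsingleton.elim _ _⟩⟩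
  have hpos : 0 < ‖(T.symm : X →L[𝕜] X)‖₊⁻¹ := inv_pos.2 T.nnnorm_symm_pos
  refine ⟨(‖(T.symm : X →L[𝕜] X)‖₊⁻¹ / 2 : NNReal), by exact_mod_cast half_pos hpos,
    fun f hf => ?_⟩
  have happ : ApproximatesLinearOn (fun x => T x + f x) (T : X →L[𝕜] X) Set.univ
      (‖(T.symm : X →L[𝕜] X)‖₊⁻¹ / 2) := by
    intro x _ y _
    have : T x + f x - (T y + f y) - (T : X →L[𝕜] X) (x - y) = f x - f y := by
      rw [map_sub, ContinuousLinearEquiv.coe_coe]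
      abel
    rw [this]
    exact hf x y
  exact ⟨happ.toHomeomorph _ (Or.inr (half_lt_self hpos)), fun x => rfl⟩

/-- A power-periodic operator on a nontrivial space is not topologically stable: it is close to
a homeomorphism that pushes points to infinity. -/
theorem not_isTopologicallyStable_of_iterate_eq [CompleteSpace X] [Nontrivial X] (T : X ≃L[𝕜] X)
    {k : ℕ} (hk : 0 < k) (hTk : ∀ v, T^[k] v = v) : ¬ IsTopologicallyStable T := by
  intro hT
  obtain ⟨U, hU, hS⟩ := hT _ (Metric.ball_mem_nhds 0 one_pos)
  obtain ⟨δ, hδ, hδU⟩ := Metric.mem_nhds_iff.1 hU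
  obtain ⟨c₀, hc₀, hhom⟩ := exists_homeomorph_add T
  let A : X →L[𝕜] X := T
  -- Summing over one period gives an equivalent norm for which `T` is an isometry.
  let N : X → ℝ := fun x => ∑ j ∈ Finset.range k, ‖(A ^ j) x‖
  let K : ℝ := ∑ j ∈ Finset.range k, ‖A ^ j‖
  have hK : 0 ≤ K := Finset.sum_nonneg fun _ _ => norm_nonneg _
  have hNK : ∀ x, N x ≤ K * ‖x‖ := fun x => by
    simp only [N, K, Finset.sum_mul]
    exact Finset.sum_le_sum fun j _ => (A ^ j).le_opNorm x
  have hN1 : ∀ x, ‖x‖ ≤ N x := fun x => by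
    exact Finset.single_le_sum (f := fun j => ‖(A ^ j) x‖) (fun _ _ => norm_nonneg _)
      (Finset.mem_range.2 hk)
  have hNadd : ∀ x y, N (x + y) ≤ N x + N y := fun x y => by
    simp only [N, ← Finset.sum_add_distrib, map_add]
    exact Finset.sum_le_sum fun j _ => norm_add_le _ _
  have hNsmul : ∀ (r : 𝕜) x, N (r • x) = ‖r‖ * N x := fun r x => by
    simp only [N, Finset.mul_sum, map_smul, norm_smul]
  have hNT : ∀ x, N (T x) = N x := fun x => by
    have h1 : ∀ j, (A ^ j) (T x) = (A ^ (j + 1)) x := fun j => by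
      rw [pow_succ]
      rfl
    have h2 : (A ^ k) x = (A ^ 0) x := by
      rw [FunLike.coe_pow_eq_iterate]
      exact hTk x
    simp only [N, h1]
    have h3 := Finset.sum_range_succ (fun j => ‖(A ^ j) x‖) k
    rw [Finset.sum_range_succ', h2] at h3
    exact add_right_cancel h3
  have hNsub : ∀ x y, |N x - N y| ≤ K * ‖x - y‖ := fun x y => by
    have h1 := hNadd (x - y) y
    have h2 := hNadd (y - x) x
    have h3 := hNK (x - y)
    have h4 := hNK (y - x)
    rw [sub_add_cancel] at h1 h2
    rw [norm_sub_rev] at h4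
    rw [abs_le]
    constructor <;> linarith
  let m : X → ℝ := fun x => max (N x) 1
  have hm1 : ∀ x, 1 ≤ m x := fun x => le_max_right _ _
  have hm0 : ∀ x, 0 < m x := fun x => one_pos.trans_le (hm1 x)
  have hmx : ∀ x, ‖x‖ ≤ m x := fun x => (hN1 x).trans (le_max_left _ _)
  -- Radial retraction onto the unit ball of `N`: bounded and Lipschitz, so `T + c • A ∘ g` is an
  -- admissible perturbation for small `c`.
  let g : X → X := fun x => (((m x)⁻¹ : ℝ) : 𝕜) • x
  have hg1 : ∀ x, ‖g x‖ ≤ 1 := fun x => by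
    simp only [g]
    rw [norm_smul, RCLike.norm_ofReal, abs_of_pos (inv_pos.2 (hm0 x)), inv_mul_le_iff₀ (hm0 x),
      mul_one]
    exact hmx x
  have hg : ∀ x y, ‖g x - g y‖ ≤ (1 + K) * ‖x - y‖ := fun x y => by
    have h1 : g x - g y = (((m x)⁻¹ : ℝ) : 𝕜) • (x - y) +
        (((m x)⁻¹ * (m y - m x) : ℝ) : 𝕜) • g y := by
      simp only [g, smul_smul, smul_sub]
      have : (m x)⁻¹ * (m y - m x) * (m y)⁻¹ = (m x)⁻¹ - (m y)⁻¹ := by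
        have := (hm0 x).ne'
        have := (hm0 y).ne'
        field_simp
      rw [← RCLike.ofReal_mul, this, RCLike.ofReal_sub, sub_smul]
      abel
    have h2 : |(m x)⁻¹| ≤ 1 := by
      rw [abs_of_pos (inv_pos.2 (hm0 x))]
      exact inv_le_one_of_one_le₀ (hm1 x)
    have h3 : |m y - m x| ≤ K * ‖x - y‖ := by
      rw [norm_sub_rev]
      exact (abs_max_sub_max_le_abs _ _ _).trans (hNsub y x)
    rw [h1]
    refine (norm_add_le _ _).trans ?_
    rw [norm_smul, norm_smul, RCLike.norm_ofReal, RCLike.norm_ofReal, abs_mul]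
    calc _ ≤ 1 * ‖x - y‖ + 1 * (K * ‖x - y‖) * 1 := by
          gcongr
          exact hg1 y
      _ = _ := by ring
  let c : ℝ := min (δ / 2) (c₀ / (1 + K)) / (‖A‖ + 1)
  have hc : 0 < c := by
    have := norm_nonneg A
    exact div_pos (lt_min (by positivity) (by positivity)) (by positivity)
  have hcA : c * ‖A‖ ≤ min (δ / 2) (c₀ / (1 + K)) := by
    have h1 : c * (‖A‖ + 1) = min (δ / 2) (c₀ / (1 + K)) :=
      div_mul_cancel₀ _ (by positivity)
    linarith
  have hAg : ∀ x, ‖(c : 𝕜) • A x‖ ≤ min (δ / 2) (c₀ / (1 + K)) * ‖x‖ := fun x => by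
    rw [norm_smul, RCLike.norm_ofReal, abs_of_pos hc]
    calc _ ≤ c * (‖A‖ * ‖x‖) := by
          gcongr
          exact A.le_opNorm x
      _ = c * ‖A‖ * ‖x‖ := by ring
      _ ≤ _ := by gcongr
  obtain ⟨S, hSf⟩ := hhom (fun x => (c : 𝕜) • A (g x)) fun x y => by
    rw [← smul_sub, ← map_sub]
    calc _ ≤ _ := hAg _
      _ ≤ c₀ / (1 + K) * ((1 + K) * ‖x - y‖) := by
        gcongr
        · exact min_le_right _ _
        · exact hg x y
      _ = _ := by field_simp
  obtain ⟨φ, -, hφT, hφ⟩ := hS S fun x => hδU <| by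
    rw [mem_ball_zero_iff, hSf, sub_add_cancel_left, norm_neg]
    calc _ ≤ _ := hAg _
      _ ≤ δ / 2 * 1 := by
        gcongr
        · exact min_le_left _ _
        · exact hg1 x
      _ < δ := by linarith
  -- Outside the unit `N`-ball, `S x` is `T x` stretched by `1 + c / N x`. Thus `N` grows linearly
  -- along an `S`-orbit, but is constant along its image under `φ`, which stays within distance `1`.
  have hNS : ∀ x, 1 ≤ N x → N (S x) = N x + c := fun x hx => by
    have hmN : m x = N x := max_eq_left hx
    have h1 : S x = ((1 + c * (m x)⁻¹ : ℝ) : 𝕜) • T x := by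
      rw [hSf, RCLike.ofReal_add, RCLike.ofReal_one, RCLike.ofReal_mul, add_smul, one_smul]
      simp only [g, A, map_smul, smul_smul, ContinuousLinearEquiv.coe_coe]
    have h2 : 0 < c * (m x)⁻¹ := mul_pos hc (inv_pos.2 (hm0 x))
    rw [h1, hNsmul, RCLike.norm_ofReal, abs_of_pos (by linarith), hNT, hmN]
    field_simp
  obtain ⟨p, hp⟩ := NormedSpace.exists_lt_norm 𝕜 X 1
  have horbit : ∀ n : ℕ, 1 + n * c ≤ N (S^[n] p) := by
    intro n
    induction n with
    | zero => simpa using hp.le.trans (hN1 p)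
    | succ n ih =>
      have : (0 : ℝ) ≤ n * c := by positivity
      rw [Function.iterate_succ_apply', hNS _ (by linarith)]
      push_cast
      linarith
  have hbdd : ∀ n : ℕ, N (φ (S^[n] p)) = N (φ p) := by
    intro n
    induction n with
    | zero => rfl
    | succ n ih => rw [Function.iterate_succ_apply', ← hφT, hNT, ih]
  obtain ⟨n, hn⟩ := exists_nat_gt ((N (φ p) + K) / c)
  rw [div_lt_iff₀ hc] at hn
  have h1 := hNadd (S^[n] p - φ (S^[n] p)) (φ (S^[n] p))
  have h2 := hNK (S^[n] p - φ (S^[n] p))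
  have h3 := mem_ball_zero_iff.1 (hφ (S^[n] p))
  rw [norm_sub_rev] at h3
  rw [sub_add_cancel, hbdd] at h1
  have h4 := horbit n
  nlinarith

/-! ### From topological stability to finite solvability. -/

/-- A map with small Lipschitz constant taking prescribed values at widely separated points. -/
theorem exists_bump_sum (𝕜 : Type*) [RCLike 𝕜] {X : Type*} [NormedAddCommGroup X]
    [NormedSpace 𝕜 X] (n : ℕ) (x e : ℕ → X) {ρ d : ℝ} (hρ : 0 < ρ) (hd : 0 ≤ d)
    (hx : ∀ i < n, ∀ j < n, i ≠ j → 2 * ρ ≤ ‖x i - x j‖) (he : ∀ j, ‖e j‖ ≤ d) :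
    ∃ f : X → X, (∀ j < n, f (x j) = e j) ∧ (∀ z, ‖f z‖ ≤ d) ∧
      ∀ z w, ‖f z - f w‖ ≤ n * (d / ρ) * ‖z - w‖ := by
  -- Tent functions on disjoint balls: at most one is nonzero at each point, so the sup bound does
  -- not grow with `n`.
  let b : ℕ → X → ℝ := fun j z => max (1 - ‖z - x j‖ / ρ) 0
  have hb0 : ∀ j z, 0 ≤ b j z := fun j z => le_max_right _ _
  have hb1 : ∀ j z, b j z ≤ 1 := fun j z =>
    max_le (sub_le_self _ (by positivity)) zero_le_one
  have hbz : ∀ j z, ρ ≤ ‖z - x j‖ → b j z = 0 := fun j z h =>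
    max_eq_right (sub_nonpos.2 ((one_le_div hρ).2 h))
  have hfar : ∀ i < n, ∀ j < n, i ≠ j → ∀ z, ‖z - x i‖ < ρ → b j z = 0 := by
    intro i hi j hj hij z hz
    refine hbz j z ?_
    have h1 := hx i hi j hj hij
    have h2 := norm_sub_le_norm_sub_add_norm_sub (x i) z (x j)
    rw [norm_sub_rev (x i) z] at h2
    linarith
  let f : X → X := fun z => ∑ j ∈ Finset.range n, (b j z : 𝕜) • e j
  have hf : ∀ i < n, ∀ z, ‖z - x i‖ < ρ → f z = (b i z : 𝕜) • e i := by
    intro i hi z hz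
    refine Finset.sum_eq_single_of_mem i (Finset.mem_range.2 hi) fun j hj hji => ?_
    rw [hfar i hi j (Finset.mem_range.1 hj) hji.symm z hz, RCLike.ofReal_zero, zero_smul]
  refine ⟨f, fun j hj => ?_, fun z => ?_, fun z w => ?_⟩
  · rw [hf j hj _ (by simpa using hρ)]
    simp [b]
  · by_cases h : ∃ i < n, ‖z - x i‖ < ρ
    · obtain ⟨i, hi, hz⟩ := h
      rw [hf i hi z hz, norm_smul, RCLike.norm_ofReal, abs_of_nonneg (hb0 i z)]
      calc _ ≤ 1 * d := mul_le_mul (hb1 i z) (he i) (norm_nonneg _) zero_le_one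
        _ = d := one_mul d
    · push Not at h
      have : f z = 0 := Finset.sum_eq_zero fun j hj => by
        rw [hbz j z (h j (Finset.mem_range.1 hj)), RCLike.ofReal_zero, zero_smul]
      rw [this, norm_zero]
      exact hd
  · have h1 : ∀ j ∈ Finset.range n, ‖(b j z : 𝕜) • e j - (b j w : 𝕜) • e j‖ ≤
        d / ρ * ‖z - w‖ := by
      intro j _
      rw [← sub_smul, ← RCLike.ofReal_sub, norm_smul, RCLike.norm_ofReal]
      have h2 : |b j z - b j w| ≤ ‖z - w‖ / ρ := by
        refine (abs_max_sub_max_le_abs _ _ _).trans ?_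
        have h3 : 1 - ‖z - x j‖ / ρ - (1 - ‖w - x j‖ / ρ) =
            (‖w - x j‖ - ‖z - x j‖) / ρ := by ring
        rw [h3, abs_div, abs_of_pos hρ, norm_sub_rev z w]
        gcongr
        simpa using abs_norm_sub_norm_le (w - x j) (z - x j)
      calc _ ≤ ‖z - w‖ / ρ * d := mul_le_mul h2 (he j) (norm_nonneg _) (by positivity)
        _ = _ := by ring
    simp only [f]
    rw [← Finset.sum_sub_distrib]
    refine (norm_sum_le_of_le _ h1).trans ?_
    simp [mul_assoc]

/-- A coincidence among the first `n` iterates gives `v` a period below `n`, which divides `n!`;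
hence any `v` not fixed by `f^[n!]` works. -/
theorem exists_iterate_ne_of_forall_exists {α : Type*} {f : α → α} (hf : Function.Injective f)
    (h : ∀ k > 0, ∃ v, f^[k] v ≠ v) (n : ℕ) :
    ∃ v, ∀ i < n, ∀ j < n, i ≠ j → f^[i] v ≠ f^[j] v := by
  by_contra! hn
  obtain ⟨v, hv⟩ := h n.factorial n.factorial_pos
  obtain ⟨i, hi, j, hj, hij, hv'⟩ := hn v
  apply hv
  have key : ∀ a b, a < n → a ≠ b → b < a → f^[a] v = f^[b] v → f^[n.factorial] v = v := by
    intro a b ha _ hba hab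
    have h1 : Function.IsPeriodicPt f (a - b) v := Function.iterate_cancel hf hab
    exact h1.trans_dvd (Nat.dvd_factorial (by omega) (by omega))
  rcases lt_or_gt_of_ne hij with h1 | h1
  · exact key j i hj hij.symm h1 hv'.symm
  · exact key i j hi hij h1 hv'

theorem eventually_le_norm_smul_add {a : X} (ha : a ≠ 0) (b : X) (ρ : ℝ) :
    ∀ᶠ R : ℝ in Filter.atTop, ρ ≤ ‖(R : 𝕜) • a + b‖ := by
  have ha' : 0 < ‖a‖ := norm_pos_iff.2 ha
  filter_upwards [Filter.eventually_ge_atTop ((ρ + ‖b‖) / ‖a‖), Filter.eventually_ge_atTop 0]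
    with R hR hR0
  rw [div_le_iff₀ ha'] at hR
  have h1 := norm_sub_le ((R : 𝕜) • a + b) b
  rw [add_sub_cancel_right, norm_smul, RCLike.norm_ofReal, abs_of_nonneg hR0] at h1
  linarith

/-- Along an orbit of `S = T + f`, the displacement `φ - id` of a semiconjugacy solves the
inhomogeneous equation; an orbit starting far from the origin admits prescribed values of `f`. -/
theorem IsTopologicallyStable.exists_finiteSolvable [CompleteSpace X] {T : X ≃L[𝕜] X}
    (hT : IsTopologicallyStable T) : ∃ C, FiniteSolvable (T : X →L[𝕜] X) C := by
  rcases subsingleton_or_nontrivial X with hX | hX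
  · exact ⟨0, fun n e _ => ⟨0, by simp, fun _ _ => Subsingleton.elim _ _⟩⟩
  have hper : ∀ k > 0, ∃ v, T^[k] v ≠ v := by
    intro k hk
    by_contra! h
    exact not_isTopologicallyStable_of_iterate_eq T hk h hT
  obtain ⟨U, hU, hS⟩ := hT _ (Metric.ball_mem_nhds 0 one_pos)
  obtain ⟨δ, hδ, hδU⟩ := Metric.mem_nhds_iff.1 hU
  obtain ⟨c₀, hc₀, hhom⟩ := exists_homeomorph_add T
  -- The displacement is below `1` for forcing of size `δ / 2`. This size does not depend on `n`;
  -- only the separation `ρ` and the scale `R` do.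
  refine ⟨(δ / 2)⁻¹, fun n e he => ?_⟩
  obtain ⟨d, hdδ⟩ : ∃ d, d = δ / 2 := ⟨_, rfl⟩
  have hd : 0 < d := hdδ ▸ half_pos hδ
  have hdk : (d : 𝕜) ≠ 0 := by exact_mod_cast hd.ne'
  rw [← hdδ]
  obtain ⟨v, hv⟩ := exists_iterate_ne_of_forall_exists T.injective hper n
  let e' : ℕ → X := fun j => -((d : 𝕜) • e j)
  have he' : ∀ j, ‖e' j‖ ≤ d := fun j => by
    simp only [e']
    rw [norm_neg, norm_smul, RCLike.norm_ofReal, abs_of_pos hd]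
    exact mul_le_of_le_one_right hd.le (he j)
  -- The forced orbit from `0`. Adding `R • T^[j] v` gives the intended `S`-orbit before `f` and `S`
  -- exist.
  let s : ℕ → X := fun n => Nat.rec 0 (fun j a => T a + e' j) n
  have hs : ∀ j, s (j + 1) = T (s j) + e' j := fun _ => rfl
  -- Chosen so that the Lipschitz bound `n * (d / ρ)` of the bump sum is at most `c₀`.
  obtain ⟨ρ, hρ⟩ : ∃ ρ, ρ = n * d / c₀ + 1 := ⟨_, rfl⟩
  have hρ0 : 0 < ρ := by
    rw [hρ]
    positivity
  have hev : ∀ᶠ R : ℝ in Filter.atTop, ∀ i ∈ Finset.range n, ∀ j ∈ Finset.range n, i ≠ j →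
      2 * ρ ≤ ‖(R : 𝕜) • (T^[i] v - T^[j] v) + (s i - s j)‖ := by
    rw [Filter.eventually_all_finset]
    intro i hi
    rw [Filter.eventually_all_finset]
    intro j hj
    rw [Filter.eventually_imp_distrib_left]
    exact fun hij => eventually_le_norm_smul_add
      (sub_ne_zero.2 (hv i (Finset.mem_range.1 hi) j (Finset.mem_range.1 hj) hij)) _ _
  obtain ⟨R, hR⟩ := hev.exists
  let x : ℕ → X := fun j => (R : 𝕜) • T^[j] v + s j
  have hx : ∀ j, x (j + 1) = T (x j) + e' j := fun j => by
    simp only [x, hs, Function.iterate_succ_apply', map_add, map_smul]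
    abel
  obtain ⟨f, hfx, hfd, hfL⟩ := exists_bump_sum 𝕜 n x e' hρ0 hd.le (fun i hi j hj hij => by
    have := hR i (Finset.mem_range.2 hi) j (Finset.mem_range.2 hj) hij
    rw [smul_sub, sub_add_sub_comm] at this
    exact this) he'
  obtain ⟨S, hSf⟩ := hhom f fun z w => (hfL z w).trans <| by
    gcongr
    rw [← mul_div_assoc, div_le_iff₀ hρ0, hρ, mul_add, mul_div_cancel₀ _ hc₀.ne']
    linarith
  obtain ⟨φ, -, hφT, hφ⟩ := hS S fun z => hδU <| by
    rw [mem_ball_zero_iff, hSf, sub_add_cancel_left, norm_neg]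
    linarith [hfd z]
  refine ⟨fun j => (d : 𝕜)⁻¹ • (φ (x j) - x j), fun j _ => ?_, fun j hj => ?_⟩
  · rw [norm_smul, norm_inv, RCLike.norm_ofReal, abs_of_pos hd]
    exact mul_le_of_le_one_right (by positivity) (mem_ball_zero_iff.1 (hφ _)).le
  · have hSx : S (x j) = x (j + 1) := by rw [hSf, hfx j hj, hx]
    have h1 : φ (x (j + 1)) - x (j + 1) = T (φ (x j) - x j) + (d : 𝕜) • e j := by
      rw [← hSx, ← hφT, hSx, hx, map_sub]
      simp only [e']
      abel
    beta_reduce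
    rw [h1, smul_add, smul_smul, inv_mul_cancel₀ hdk, one_smul, map_smul,
      ContinuousLinearEquiv.coe_coe]

end

theorem corollary3p3 {𝕜 : Type*} [RCLike 𝕜] {X : Type*} [NormedAddCommGroup X] [NormedSpace 𝕜 X]
    [CompleteSpace X] (T : X ≃L[𝕜] X) (hT : OperatorDynamics.IsTopologicallyStable T) :
    OperatorDynamics.HasShadowingProperty T ∧
      OperatorDynamics.HasStrictPeriodicShadowingProperty (T : X →L[𝕜] X) := by
  obtain ⟨C, hC⟩ := IsTopologicallyStable.exists_finiteSolvable hT
  exact ⟨hC.hasShadowingProperty, hC.hasStrictPeriodicShadowingProperty⟩
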